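/- Let $\Omega\subsetneq\mathbb{R}^n$ be an open convex set with finite inradius $\delta_0=\sup_{x\in\Omega}\delta(x)$, where $\delta(x)=\operatorname{dist}(x,\partial\Omega)$, and let $g\in C_0^1(\Omega)$, i.e. $g:\Omega\to\mathbb{R}$ is continuously differentiable with compact support in $\Omega$. Let $J_\nu(x)=\sum_{k\ge 0}\frac{(-1)^k (x/2)^{2k+\nu}}{k!\,\Gamma(k+1+\nu)}$ be the Bessel function of order $\nu$ and $j_\nu$ its first positive zero. For given $m,\nu,\lambda$ let $c_\nu(m)$ (which also depends on $\lambda$) denote a number satisfying $$(1-2\lambda)J_\nu\!\left(\tfrac{2}{m}c_\nu(m)\right)+2c_\nu(m)J_\nu'\!\left(\tfrac{2}{m}c_\nu(m)\right)=0\quad\text{and}\quad \tfrac{2}{m}c_\nu(m)\in(0,j_\nu).$$ (i) If $m>1$, $\nu\in[0,1/m]$ and $\lambda\in\left[0,\frac{1+\nu m}{2}\right)$, then $$\frac{1-\nu^2m^2}{4}\int_\Omega\frac{|g(x)|^2}{\delta(x)^2}\,dx+\frac{c_\nu^2(m)+(m-1)(\lambda-\lambda^2)}{\delta_0^m}\int_\Omega\frac{|g(x)|^2}{\delta(x)^{2-m}}\,dx\le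 4\left(\frac{1+\nu m}{2}-\lambda^2\right)\int_\Omega|\nabla g(x)|^2\,dx.$$ (ii) If $m>0$, $\nu\in[0,1/m]$ and $\lambda\le 0$, then $$\frac{1-\nu^2m^2}{4}\int_\Omega\frac{|g(x)|^2}{\delta(x)^2}\,dx+\frac{c_\nu^2(m)}{\delta_0^m}\int_\Omega\frac{|g(x)|^2}{\delta(x)^{2-m}}\,dx\le \bigl(2(1+\nu m)+|\lambda|\bigr)\int_\Omega|\nabla g(x)|^2\,dx.$$ -/

import Mathlib

open MeasureTheory

namespace LambHardy

noncomputable section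

/-- The Bessel function of the first kind `J_ν(x)`, for real order `ν` and `x > 0`. -/
def besselJ (ν x : ℝ) : ℝ :=
  ∑' k : ℕ, (-1 : ℝ) ^ k * (x / 2) ^ (2 * (k : ℝ) + ν) /
    ((k.factorial : ℝ) * Real.Gamma ((k : ℝ) + 1 + ν))

/-- The first positive zero `j_ν` of the Bessel function `J_ν`. -/
def besselFirstZero (ν : ℝ) : ℝ :=
  sInf {x : ℝ | 0 < x ∧ besselJ ν x = 0}

/-- `c` is a Lamb constant `c_ν(m)` with parameter `lam`: it solves the parametric Lamb equation
and `2c/m` lies in `(0, j_ν)`. -/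
def IsLambConstant (m ν lam c : ℝ) : Prop :=
  (1 - 2 * lam) * besselJ ν (2 / m * c) + 2 * c * deriv (besselJ ν) (2 / m * c) = 0 ∧
    2 / m * c ∈ Set.Ioo 0 (besselFirstZero ν)

/-- The distance `δ(x)` from `x` to the boundary of `Ω`. -/
def bdryDist {n : ℕ} (Ω : Set (EuclideanSpace ℝ (Fin n))) (x : EuclideanSpace ℝ (Fin n)) : ℝ :=
  Metric.infDist x (frontier Ω)

/-- The inradius `δ₀(Ω)`, the supremum of `δ` over `Ω`. -/
def inradius {n : ℕ} (Ω : Set (EuclideanSpace ℝ (Fin n))) : ℝ :=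
  sSup (bdryDist Ω '' Ω)

/-- Finiteness of the inradius of `Ω`. The whole space, which has no boundary, is excluded. -/
def FiniteInradius {n : ℕ} (Ω : Set (EuclideanSpace ℝ (Fin n))) : Prop :=
  Ω ≠ Set.univ ∧ BddAbove (bdryDist Ω '' Ω)

/-- `C_0^1(Ω)`: continuously differentiable functions with compact support lying in `Ω`
(extended by zero outside `Ω`). -/
def IsC1c {n : ℕ} (Ω : Set (EuclideanSpace ℝ (Fin n)))
    (g : EuclideanSpace ℝ (Fin n) → ℝ) : Prop :=
  ContDiff ℝ 1 g ∧ HasCompactSupport g ∧ tsupport g ⊆ Ω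

end

end LambHardy

/-!
The distance `δ` to the boundary of a convex set is concave, hence weakly superharmonic, and
`|∇δ| = 1` almost everywhere. Testing superharmonicity against `g² φ(δ)`, for a nonnegative profile
`φ`, gives the Hardy inequality `∫ g² (-φ'(δ) - φ(δ)²) ≤ ∫ |∇g|²` (`integral_sq_mul_riccati_le`).
Superharmonicity itself is obtained without second derivatives
(`integral_lineDeriv_mul_lineDeriv_nonneg`): second differences of a concave function are
nonpositive, summation by parts turns them into products of first differences, and Rademacher's
theorem with dominated convergence passes to the limit.

The optimal profile for the Lamb constant is the logarithmic derivative of `√x J_ν((2c/m) x^{m/2})`,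
but the constants in front of `∫ |∇g|²` leave enough room for the elementary profile
`φ(s) = α/s - β s^{m-1}/δ₀^m` with `0 ≤ β ≤ α`. It produces the weights `α - α²` on `g²/δ²` and
`β(m - 1 + 2α) - β²` on `δ₀^{-m} g²/δ^{2-m}` (`hardy_two_weights`).

What remains is to choose `α` and `β` so that these weights, multiplied by the constant on the
right-hand side, dominate the required ones (`exists_profile_of_nonneg`, `exists_profile_of_nonpos`).
This takes an upper bound for `c` in terms of `μ - λ`, where `μ = (1 + νm)/2`. Writing
`J_ν(x) = (x/2)^ν F_ν(x²/4)`, the Lamb equation with `t = c²/m²` says `μ - λ = m t F_{ν+1}(t)/F_ν(t)`.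
Since `(t^{ν+1} F_{ν+1})' = t^ν F_ν`, positivity of `F_ν` before its first zero is inherited by
`F_{ν+1}, F_{ν+2}, …`, and the three-term recurrence then bounds `F_{ν+1}/F_ν` below by the first two
terms of its Taylor expansion (`LambHardy.IsLambConstant.two_term_bound`).
-/

/-! ### The power series behind the Bessel function -/

/-- The entire function `F_ν(t) = ∑ (-t)^k / (k! Γ(k+1+ν))`, normalised so that
`J_ν(x) = (x/2)^ν F_ν(x²/4)` for `x > 0`. -/
noncomputable def besselSeries (ν t : ℝ) : ℝ :=
  ∑' k : ℕ, (-t) ^ k / ((k.factorial : ℝ) * Real.Gamma ((k : ℝ) + 1 + ν))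

namespace besselSeries

lemma exists_gamma_lower_bound {ν : ℝ} (hν : 0 ≤ ν) :
    ∃ G : ℝ, 0 < G ∧ ∀ k : ℕ, G ≤ Real.Gamma ((k : ℝ) + 1 + ν) := by
  refine ⟨min 1 (Real.Gamma (1 + ν)), lt_min one_pos (Real.Gamma_pos_of_pos (by linarith)), ?_⟩
  rintro (_ | k)
  · simp
  · refine (min_le_left _ _).trans ?_
    refine Real.Gamma_two.symm.le.trans ?_
    refine Real.Gamma_strictMonoOn_Ici.monotoneOn (Set.mem_Ici.2 le_rfl)
      (Set.mem_Ici.2 ?_) ?_ <;> push_cast <;> linarith [(Nat.cast_nonneg k : (0 : ℝ) ≤ k)]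

lemma summable_term {ν : ℝ} (hν : 0 ≤ ν) (t : ℝ) :
    Summable fun k : ℕ => (-t) ^ k / ((k.factorial : ℝ) * Real.Gamma ((k : ℝ) + 1 + ν)) := by
  obtain ⟨G, hG, hle⟩ := exists_gamma_lower_bound hν
  refine Summable.of_norm_bounded ((Real.summable_pow_div_factorial |t|).mul_left G⁻¹) fun k => ?_
  have hf : (0 : ℝ) < k.factorial := by positivity
  rw [norm_div, norm_pow, norm_neg, Real.norm_eq_abs, Real.norm_of_nonneg
    (mul_nonneg hf.le (hG.le.trans (hle k))), inv_mul_eq_div, div_div]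
  have := hle k
  gcongr

lemma hasDerivAt {ν : ℝ} (hν : 0 ≤ ν) (t : ℝ) :
    HasDerivAt (besselSeries ν) (-besselSeries (ν + 1) t) t := by
  obtain ⟨G, hG, hle⟩ := exists_gamma_lower_bound hν
  set R := |t| + 1
  have hR : 0 < R := by positivity
  let d : ℕ → ℝ → ℝ := fun k s =>
    k * (-s) ^ (k - 1) * (-1) / ((k.factorial : ℝ) * Real.Gamma ((k : ℝ) + 1 + ν))
  let u : ℕ → ℝ := fun k => k * R ^ (k - 1) / ((k.factorial : ℝ) * G)
  have hu : Summable u := by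
    rw [← summable_nat_add_iff 1]
    refine ((Real.summable_pow_div_factorial R).mul_left G⁻¹).congr fun k => ?_
    simp only [u, Nat.factorial_succ, Nat.add_sub_cancel]
    push_cast
    field_simp
  have hbound : ∀ k s, |s| ≤ R → ‖d k s‖ ≤ u k := by
    intro k s hs
    have hf : (0 : ℝ) < k.factorial := by positivity
    have := hle k
    simp only [d, u]
    rw [norm_div, norm_mul, norm_mul, norm_pow, norm_neg, norm_neg, norm_one, mul_one,
      Real.norm_eq_abs s, Real.norm_of_nonneg (mul_nonneg hf.le (hG.le.trans (hle k))),
      Real.norm_of_nonneg (Nat.cast_nonneg k)]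
    gcongr
  have hmain : HasDerivAt (besselSeries ν) (∑' k, d k t) t := by
    refine hasDerivAt_tsum_of_isPreconnected (u := u) (t := Metric.ball 0 R) (y₀ := 0) hu
      Metric.isOpen_ball (convex_ball _ _).isPreconnected (fun k s _ => ?_) (fun k s hs => ?_)
      (by simpa using hR) (summable_term hν 0) (by simp [R])
    · exact ((hasDerivAt_neg s).pow k).div_const _
    · exact hbound k s (by simpa using (Metric.mem_ball.1 hs).le)
  have hsum : ∑' k, d k t = -besselSeries (ν + 1) t := by
    have hd : Summable fun k => d k t := Summable.of_norm_bounded hu fun k =>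
      hbound k t (by simp [R])
    rw [hd.tsum_eq_zero_add]
    simp only [besselSeries, d, Nat.cast_zero, zero_mul, zero_div, zero_add, ← tsum_neg]
    refine tsum_congr fun k => ?_
    have hg : Real.Gamma (((k + 1 : ℕ) : ℝ) + 1 + ν) = Real.Gamma ((k : ℝ) + 1 + (ν + 1)) := by
      push_cast; ring_nf
    have hg0 : Real.Gamma ((k : ℝ) + 1 + (ν + 1)) ≠ 0 := (Real.Gamma_pos_of_pos (by positivity)).ne'
    rw [hg, Nat.factorial_succ]
    push_cast
    field_simp
  rwa [hsum] at hmain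

/-- Contiguity relation, the power-series form of `J_ν + J_{ν+2} = (2(ν+1)/x) J_{ν+1}`. -/
lemma contiguous {ν : ℝ} (hν : 0 ≤ ν) (t : ℝ) :
    (ν + 1) * besselSeries (ν + 1) t = besselSeries ν t + t * besselSeries (ν + 2) t := by
  have h0 := summable_term hν t
  have h1 := summable_term (show 0 ≤ ν + 1 by linarith) t
  have h2 := summable_term (show 0 ≤ ν + 2 by linarith) t
  simp only [besselSeries]
  rw [h1.tsum_eq_zero_add, h0.tsum_eq_zero_add, ← tsum_mul_left, mul_add, ← tsum_mul_left,
    add_assoc (_ / _), ← Summable.tsum_add ((summable_nat_add_iff 1).2 h0) (h2.mul_left t)]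
  congr 1
  · have : Real.Gamma (0 + 1 + (ν + 1)) = (ν + 1) * Real.Gamma (0 + 1 + ν) := by
      have := Real.Gamma_add_one (show ν + 1 ≠ 0 by positivity)
      ring_nf at this ⊢
      exact this
    have hg : Real.Gamma (0 + 1 + ν) ≠ 0 := (Real.Gamma_pos_of_pos (by positivity)).ne'
    simp only [Nat.cast_zero, this]
    field_simp
  · refine tsum_congr fun k => ?_
    have e1 : Real.Gamma (((k + 1 : ℕ) : ℝ) + 1 + (ν + 1))
        = (k + 2 + ν) * Real.Gamma ((k : ℝ) + 2 + ν) := by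
      rw [← Real.Gamma_add_one (by positivity)]; push_cast; ring_nf
    have e2 : Real.Gamma (((k + 1 : ℕ) : ℝ) + 1 + ν) = Real.Gamma ((k : ℝ) + 2 + ν) := by
      push_cast; ring_nf
    have e3 : Real.Gamma ((k : ℝ) + 1 + (ν + 2)) = (k + 2 + ν) * Real.Gamma ((k : ℝ) + 2 + ν) := by
      rw [← Real.Gamma_add_one (by positivity)]; ring_nf
    have hg : Real.Gamma ((k : ℝ) + 2 + ν) ≠ 0 := (Real.Gamma_pos_of_pos (by positivity)).ne'
    have hk : (k : ℝ) + 2 + ν ≠ 0 := by positivity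
    rw [e1, e2, e3, Nat.factorial_succ, pow_succ]
    push_cast
    field_simp
    ring

lemma continuous {ν : ℝ} (hν : 0 ≤ ν) : Continuous (besselSeries ν) :=
  continuous_iff_continuousAt.2 fun t => (hasDerivAt hν t).continuousAt

lemma zero_pos {ν : ℝ} (hν : 0 ≤ ν) : 0 < besselSeries ν 0 := by
  have : besselSeries ν 0 = (Real.Gamma (1 + ν))⁻¹ := by
    rw [besselSeries, tsum_eq_single 0 (fun k hk => by simp [hk])]
    simp
  rw [this]
  exact inv_pos.2 (Real.Gamma_pos_of_pos (by linarith))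

/-- Positivity of `F_ν` on `[0, T]` passes to `F_{ν+1}`, because
`(t^{ν+1} F_{ν+1})' = t^ν F_ν`. -/
lemma pos_succ {ν T : ℝ} (hν : 0 ≤ ν) (h : ∀ t ∈ Set.Icc 0 T, 0 < besselSeries ν t) :
    ∀ t ∈ Set.Icc 0 T, 0 < besselSeries (ν + 1) t := by
  have hν1 : 0 ≤ ν + 1 := by linarith
  have hmono : StrictMonoOn (fun t : ℝ => t ^ (ν + 1) * besselSeries (ν + 1) t) (Set.Icc 0 T) := by
    refine strictMonoOn_of_deriv_pos (convex_Icc 0 T) ?_ fun t ht => ?_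
    · exact ((Real.continuous_rpow_const hν1).mul (continuous hν1)).continuousOn
    · rw [interior_Icc] at ht
      have hd := (Real.hasDerivAt_rpow_const (x := t) (p := ν + 1) (Or.inl ht.1.ne')).mul
        (hasDerivAt hν1 t)
      have hc := contiguous hν t
      rw [show ν + 1 + 1 = ν + 2 by ring] at hd
      have he : (ν + 1) * t ^ (ν + 1 - 1) * besselSeries (ν + 1) t +
          t ^ (ν + 1) * -besselSeries (ν + 2) t = t ^ ν * besselSeries ν t := by
        rw [add_sub_cancel_right, Real.rpow_add_one ht.1.ne']
        linear_combination t ^ ν * hc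
      have := hd.deriv
      rw [he] at this
      refine lt_of_lt_of_eq ?_ this.symm
      exact mul_pos (Real.rpow_pos_of_pos ht.1 _) (h t ⟨ht.1.le, ht.2.le⟩)
  intro t ht
  rcases ht.1.eq_or_lt with h0 | h0
  · rw [← h0]; exact zero_pos hν1
  · have := hmono ⟨le_rfl, ht.1.trans ht.2⟩ ht h0
    simp only [Real.zero_rpow (show ν + 1 ≠ 0 by linarith), zero_mul] at this
    exact (mul_pos_iff_of_pos_left (Real.rpow_pos_of_pos h0 _)).1 this

/-- The first two terms of the expansion of `F_{ν+1}/F_ν`, whose coefficients are Rayleigh sums,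
bound it from below up to the first zero of `F_ν`. -/
lemma ratio_lower_bound {ν T : ℝ} (hν : 0 ≤ ν) (hT : 0 ≤ T)
    (h : ∀ t ∈ Set.Icc 0 T, 0 < besselSeries ν t) :
    (1 / (1 + ν) + T / ((1 + ν) ^ 2 * (2 + ν))) * besselSeries ν T ≤ besselSeries (ν + 1) T := by
  have h1 := pos_succ hν h
  have h2 := pos_succ (by linarith) h1
  have h3 := pos_succ (by linarith) h2
  have hm : T ∈ Set.Icc 0 T := ⟨hT, le_rfl⟩
  have c0 := contiguous hν T
  have c1 := contiguous (show 0 ≤ ν + 1 by linarith) T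
  have p1 := h1 T hm
  have p2 := h2 T hm
  have p3 := h3 T hm
  rw [show ν + 1 + 2 = ν + 1 + 1 + 1 by ring] at c1
  rw [show ν + 2 = ν + 1 + 1 by ring] at c0
  set f0 := besselSeries ν T
  set f1 := besselSeries (ν + 1) T
  set f2 := besselSeries (ν + 1 + 1) T
  set f3 := besselSeries (ν + 1 + 1 + 1) T
  have a1 : f0 ≤ (ν + 1) * f1 := by nlinarith
  have a2 : f1 ≤ (ν + 2) * f2 := by nlinarith
  have a3 : f0 ≤ (ν + 1) * (ν + 2) * f2 := by nlinarith
  have a4 : T * f0 ≤ T * ((ν + 1) * (ν + 2) * f2) := mul_le_mul_of_nonneg_left a3 hT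
  have e : f1 - (1 / (1 + ν) + T / ((1 + ν) ^ 2 * (2 + ν))) * f0
      = (T * ((ν + 1) * (ν + 2) * f2) - T * f0) / ((1 + ν) ^ 2 * (2 + ν)) := by
    field_simp
    linear_combination (2 + ν) * (1 + ν) * c0
  have : 0 ≤ (T * ((ν + 1) * (ν + 2) * f2) - T * f0) / ((1 + ν) ^ 2 * (2 + ν)) :=
    div_nonneg (sub_nonneg.2 a4) (by positivity)
  linarith

end besselSeries

/-! ### Bounds for the Lamb constant -/

lemma besselJ_eq_rpow_mul_besselSeries {ν x : ℝ} (hx : 0 < x) :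
    LambHardy.besselJ ν x = (x / 2) ^ ν * besselSeries ν (x ^ 2 / 4) := by
  rw [LambHardy.besselJ, besselSeries, ← tsum_mul_left]
  refine tsum_congr fun k => ?_
  have hx2 : 0 < x / 2 := by positivity
  rw [Real.rpow_add hx2, show (2 * (k : ℝ)) = ((2 * k : ℕ) : ℝ) by push_cast; ring,
    Real.rpow_natCast, pow_mul, neg_pow (x ^ 2 / 4), show x ^ 2 / 4 = (x / 2) ^ 2 by ring]
  ring

lemma mul_deriv_besselJ {ν x : ℝ} (hν : 0 ≤ ν) (hx : 0 < x) :
    x * deriv (LambHardy.besselJ ν) x =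
      (x / 2) ^ ν * (ν * besselSeries ν (x ^ 2 / 4)
        - 2 * (x ^ 2 / 4) * besselSeries (ν + 1) (x ^ 2 / 4)) := by
  have hx2 : 0 < x / 2 := by positivity
  have heq : LambHardy.besselJ ν =ᶠ[nhds x]
      fun y => (y / 2) ^ ν * besselSeries ν (y ^ 2 / 4) := by
    filter_upwards [lt_mem_nhds hx] with y hy using besselJ_eq_rpow_mul_besselSeries hy
  have h1 : HasDerivAt (fun y : ℝ => (y / 2) ^ ν) (1 / 2 * ν * (x / 2) ^ (ν - 1)) x :=
    ((hasDerivAt_id x).div_const 2).rpow_const (Or.inl hx2.ne')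
  have h2 : HasDerivAt (fun y : ℝ => besselSeries ν (y ^ 2 / 4))
      (-besselSeries (ν + 1) (x ^ 2 / 4) * (2 * x / 4)) x := by
    have := (besselSeries.hasDerivAt hν (x ^ 2 / 4)).comp x (((hasDerivAt_id x).pow 2).div_const 4)
    convert! this using 1
    simp
  rw [heq.deriv_eq, (h1.fun_mul h2).deriv, Real.rpow_sub_one hx2.ne']
  field_simp
  ring

/-- Below the first positive zero of `J_ν`, the series `F_ν` is positive. -/
lemma besselSeries_pos_of_lt_firstZero {ν z : ℝ} (hν : 0 ≤ ν)
    (hz : z ∈ Set.Ioo 0 (LambHardy.besselFirstZero ν)) :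
    ∀ t ∈ Set.Icc 0 (z ^ 2 / 4), 0 < besselSeries ν t := by
  have hne : ∀ t ∈ Set.Icc 0 (z ^ 2 / 4), besselSeries ν t ≠ 0 := by
    intro t ht h0
    rcases ht.1.eq_or_lt with ht0 | ht0
    · rw [← ht0] at h0; exact (besselSeries.zero_pos hν).ne' h0
    · have hs : 0 < √t := Real.sqrt_pos.2 ht0
      have hsq : (2 * √t) ^ 2 / 4 = t := by rw [mul_pow, Real.sq_sqrt ht0.le]; ring
      have hle : 2 * √t ≤ z := by
        refine abs_le_of_sq_le_sq' ?_ hz.1.le |>.2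
        linarith [ht.2]
      refine notMem_of_lt_csInf (hle.trans_lt hz.2) ⟨0, fun y hy => hy.1.le⟩ ⟨by positivity, ?_⟩
      rw [besselJ_eq_rpow_mul_besselSeries (by positivity), hsq, h0, mul_zero]
  intro t ht
  by_contra! hneg
  obtain ⟨s, hs, hs0⟩ := intermediate_value_Icc' ht.1 (besselSeries.continuous hν).continuousOn
    ⟨hneg, (besselSeries.zero_pos hν).le⟩
  exact hne s ⟨hs.1, hs.2.trans ht.2⟩ hs0

/-- The Lamb equation forces the two-term bound `C + C²/(2m + νm) ≤ (1+νm)/2 - λ` on the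
normalised constant `C = c²/(m + νm)`. -/
lemma LambHardy.IsLambConstant.two_term_bound {m ν lam c : ℝ} (hm : 0 < m) (hν : 0 ≤ ν)
    (h : LambHardy.IsLambConstant m ν lam c) :
    c ^ 2 / (m + ν * m) + (c ^ 2 / (m + ν * m)) ^ 2 / (2 * m + ν * m)
      ≤ (1 + ν * m) / 2 - lam := by
  obtain ⟨heq, hz⟩ := h
  have hpos := besselSeries_pos_of_lt_firstZero hν hz
  set z := 2 / m * c with hzdef
  have hc : c = m * z / 2 := by rw [hzdef]; field_simp
  have hz0 : 0 < z := hz.1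
  have hP : 0 < (z / 2) ^ ν := by positivity
  have hd := mul_deriv_besselJ hν hz0
  have hT : 0 ≤ z ^ 2 / 4 := by positivity
  have hr := besselSeries.ratio_lower_bound hν hT hpos
  have hf := hpos _ ⟨hT, le_rfl⟩
  rw [besselJ_eq_rpow_mul_besselSeries hz0, show 2 * c = m * z by rw [hc]; ring] at heq
  have hct : c ^ 2 = m ^ 2 * (z ^ 2 / 4) := by rw [hc]; ring
  rw [hct]
  set T := z ^ 2 / 4
  set f0 := besselSeries ν T
  set f1 := besselSeries (ν + 1) T
  have hlam : ((1 + ν * m) / 2 - lam) * f0 = m * T * f1 := by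
    have : (z / 2) ^ ν * (((1 - 2 * lam) + m * ν) * f0 - 2 * m * T * f1) = 0 := by
      linear_combination heq - m * hd
    rcases mul_eq_zero.1 this with h | h
    · exact absurd h hP.ne'
    · linear_combination h / 2
  refine le_of_mul_le_mul_right ?_ hf
  rw [hlam]
  calc _ = m * T * ((1 / (1 + ν) + T / ((1 + ν) ^ 2 * (2 + ν))) * f0) := by field_simp
    _ ≤ m * T * f1 := mul_le_mul_of_nonneg_left hr (by positivity)

/-! ### Choice of the profile parameters -/

/-- With `α = 1 - 2a`, `a = μ(1-μ)/K ∈ [0, 1/4]`, the first coefficient is large enough: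
`α(1-α) = 2a(1-2a) ≥ a`. -/
lemma mul_profile_sub_sq_ge {K q : ℝ} (hK : 0 < K) (hq : 0 ≤ q) (h : 4 * q ≤ K) :
    q ≤ K * ((1 - 2 * (q / K)) - (1 - 2 * (q / K)) ^ 2) := by
  obtain ⟨a, rfl⟩ : ∃ a, q = a * K := ⟨q / K, by field_simp⟩
  rw [mul_div_assoc, div_self hK.ne', mul_one]
  have h4 : a ≤ 1 / 4 := by nlinarith
  have h0 : 0 ≤ a := nonneg_of_mul_nonneg_left hq hK
  nlinarith [mul_nonneg (mul_nonneg h0 hK.le) (sub_nonneg.2 h4)]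

/-- The parameters for `0 ≤ λ < μ = (1 + νm)/2`, with `K = 4(μ - λ²)` and `β = α`. Of the bound on
`c²`, only `c² ≤ (m + 2μ - 1)(μ - λ)` is needed here. -/
lemma exists_profile_of_nonneg {m μ lam c : ℝ} (hm : 1 < m) (hμ : 1 / 2 ≤ μ) (hμ1 : μ ≤ 1)
    (hl : 0 ≤ lam) (hlμ : lam < μ) (hc : c ^ 2 / (m + 2 * μ - 1) ≤ μ - lam) :
    ∃ α β : ℝ, 0 ≤ β ∧ β ≤ α ∧ μ * (1 - μ) ≤ 4 * (μ - lam ^ 2) * (α - α ^ 2) ∧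
      c ^ 2 + (m - 1) * (lam - lam ^ 2) ≤
        4 * (μ - lam ^ 2) * (β * (m - 1 + 2 * α) - β ^ 2) := by
  set K := 4 * (μ - lam ^ 2) with hKdef
  set q := μ * (1 - μ) with hqdef
  have hq : 0 ≤ q := mul_nonneg (by linarith) (by linarith)
  have hsq : lam ^ 2 ≤ lam := by nlinarith
  have hK : 0 < K := by linarith
  have h4 : 4 * q ≤ K := by nlinarith
  have hc' : c ^ 2 ≤ (μ - lam) * (m + 2 * μ - 1) := (div_le_iff₀ (by linarith)).1 hc
  set α := 1 - 2 * (q / K) with hα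
  have haK : q / K ≤ 1 / 4 := by rw [div_le_iff₀ hK]; linarith
  have hαK : α * K = K - 2 * q := by rw [hα]; field_simp
  have hα2 : 1 / 2 ≤ α := by linarith
  refine ⟨α, α, by linarith, le_rfl, mul_profile_sub_sq_ge hK hq h4, ?_⟩
  -- `(Kα)² = (K - 2q)²`, expanded in powers of `s = μ - λ`, dominates `2 μ s K`
  have key : 2 * μ * (μ - lam) ≤ K * α ^ 2 := by
    refine le_of_mul_le_mul_right ?_ hK
    have e : K * α ^ 2 * K = (K - 2 * q) ^ 2 := by rw [← hαK]; ring
    rw [e]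
    obtain ⟨s, hs⟩ : ∃ s, s = μ - lam := ⟨_, rfl⟩
    have hs0 : 0 ≤ s := by linarith
    set w := 8 * μ * s - 4 * s ^ 2 with hw
    have hKw : K = 4 * q + w := by
      rw [hKdef, hqdef, hw, show lam = μ - s by linarith]; ring
    have hws : 4 * μ * s ≤ w := by nlinarith
    rw [hKw, ← hs]
    have hμs : 0 ≤ μ * s := by nlinarith
    nlinarith [mul_nonneg hq hμs, mul_nonneg hq (sub_nonneg.2 hws), sq_nonneg q,
      mul_nonneg (show 0 ≤ w by linarith) (sub_nonneg.2 hws),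
      mul_nonneg hμs (show 0 ≤ w by linarith)]
  have h1 : (m - 1) * (μ - lam ^ 2) ≤ (m - 1) * (K * α) := by
    refine mul_le_mul_of_nonneg_left ?_ (by linarith)
    nlinarith
  nlinarith

/-- The second weight condition for `β = α = 1 - 2a` and `m ≥ 1`; here `C = c²/(m + 2μ - 1)` and
`D = C²/(2m + 2μ - 1)`. -/
lemma two_term_estimate_of_one_le {m μ C D K a : ℝ} (hm : 1 ≤ m) (hμ : 1 / 2 ≤ μ) (hμ1 : μ ≤ 1)
    (ha : 0 ≤ a) (haK : a * K = μ * (1 - μ)) (hD : 0 ≤ D)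
    (hCD : C ^ 2 = D * (2 * m + 2 * μ - 1)) (hKD : 3 * μ + C + D ≤ K) :
    (m + 2 * μ - 1) * C ≤ K * ((1 - 2 * a) * (m - 1 + 2 * (1 - 2 * a)) - (1 - 2 * a) ^ 2) := by
  have hq : 0 ≤ μ * (1 - μ) := mul_nonneg (by linarith) (by linarith)
  have e : K * ((1 - 2 * a) * (m - 1 + 2 * (1 - 2 * a)) - (1 - 2 * a) ^ 2)
      = m * (K - 2 * (μ * (1 - μ))) - 2 * (μ * (1 - μ)) + 4 * (a * (μ * (1 - μ))) := by
    rw [← haK]; ring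
  have hKm : m * (3 * μ + C + D) ≤ m * K := mul_le_mul_of_nonneg_left hKD (by linarith)
  -- the remainder after the leading terms `m C` cancel is a quadratic in `C` without real roots
  have hmD : C ^ 2 / 3 ≤ m * D := by
    have : D * (2 * m + 2 * μ - 1) ≤ D * (3 * m) := mul_le_mul_of_nonneg_left (by linarith) hD
    linarith
  have hconst : 4 * μ ^ 2 - μ ≤ m * (3 * μ - 2 * (μ * (1 - μ))) - 2 * (μ * (1 - μ)) := by
    have : 1 * (μ + 2 * μ ^ 2) ≤ m * (μ + 2 * μ ^ 2) :=
      mul_le_mul_of_nonneg_right hm (by positivity)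
    linarith
  have hdisc : (2 * μ - 1) * C ≤ C ^ 2 / 3 + (4 * μ ^ 2 - μ) := by
    have : 0 ≤ (μ - 1 / 2) * μ := mul_nonneg (by linarith) (by linarith)
    linarith [sq_nonneg (C - 3 / 2 * (2 * μ - 1))]
  rw [e]
  linarith [mul_nonneg ha hq]

lemma two_term_estimate_of_lt_one {m μ C : ℝ} (hm : 0 < m) (hm1 : m < 1) (hμ : 1 / 2 ≤ μ)
    (hμ1 : μ ≤ 1) :
    4 * (m + 2 * μ - 1) * C ≤ (2 * m + 2 * μ - 1) * (3 * μ + C) + C ^ 2 := by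
  have hm2 : 0 ≤ m * (1 - m) := mul_nonneg hm.le (by linarith)
  have hμ2 : 0 ≤ (2 * μ - 1) * (1 - μ) := mul_nonneg (by linarith) (by linarith)
  linarith [sq_nonneg (2 * C - (2 * m + 3 * (2 * μ - 1)))]

/-- The parameters for `λ ≤ 0`, with `K = 4μ + |λ|`. As `λ → -∞` the constant `c` stays bounded
while `μ - λ` does not, so the quadratic term in the bound on `c²` is essential. For `m < 1` the
choice `β = α` may give a negative weight, and `β` is taken as the maximiser of
`β (m - 1 + 2α) - β²`. -/
lemma exists_profile_of_nonpos {m μ lam c : ℝ} (hm : 0 < m) (hμ : 1 / 2 ≤ μ) (hμ1 : μ ≤ 1)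
    (hl : lam ≤ 0) (hc : c ^ 2 / (m + 2 * μ - 1) +
      (c ^ 2 / (m + 2 * μ - 1)) ^ 2 / (2 * m + 2 * μ - 1) ≤ μ - lam) :
    ∃ α β : ℝ, 0 ≤ β ∧ β ≤ α ∧ μ * (1 - μ) ≤ (4 * μ - lam) * (α - α ^ 2) ∧
      c ^ 2 ≤ (4 * μ - lam) * (β * (m - 1 + 2 * α) - β ^ 2) := by
  set K := 4 * μ - lam with hKdef
  set q := μ * (1 - μ) with hqdef
  have hq : 0 ≤ q := mul_nonneg (by linarith) (by linarith)
  have hK : 0 < K := by linarith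
  have h4 : 4 * q ≤ K := by nlinarith
  have hN : 0 < m + 2 * μ - 1 := by linarith
  obtain ⟨C, hC⟩ : ∃ C, C = c ^ 2 / (m + 2 * μ - 1) := ⟨_, rfl⟩
  have hC0 : 0 ≤ C := by rw [hC]; positivity
  have hcC : c ^ 2 = (m + 2 * μ - 1) * C := by rw [hC]; field_simp
  rw [← hC] at hc
  have hM : 0 < 2 * m + 2 * μ - 1 := by linarith
  have hCD : C ^ 2 = (C ^ 2 / (2 * m + 2 * μ - 1)) * (2 * m + 2 * μ - 1) :=
    (div_mul_cancel₀ _ hM.ne').symm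
  set D := C ^ 2 / (2 * m + 2 * μ - 1)
  have hD0 : 0 ≤ D := by positivity
  have hKD : 3 * μ + C + D ≤ K := by linarith
  obtain ⟨a, ha⟩ : ∃ a, a = q / K := ⟨_, rfl⟩
  have haK : a * K = q := by rw [ha]; field_simp
  have ha0 : 0 ≤ a := by rw [ha]; positivity
  have ha1 : 2 * a ≤ (1 - μ) / 2 := by
    have : a * (4 * μ) ≤ a * K := mul_le_mul_of_nonneg_left (by linarith) ha0
    have h2 : μ * (4 * a) ≤ μ * (1 - μ) := by linarith
    have := le_of_mul_le_mul_left h2 (by linarith)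
    linarith
  have hprof := mul_profile_sub_sq_ge hK hq h4
  rw [← ha] at hprof
  rcases le_or_gt 1 m with hm1 | hm1
  · refine ⟨1 - 2 * a, 1 - 2 * a, by linarith, le_rfl, hprof, ?_⟩
    rw [hcC]
    exact two_term_estimate_of_one_le hm1 hμ hμ1 ha0 haK hD0 hCD hKD
  · have hβ : (m + μ) / 2 ≤ (m - 1 + 2 * (1 - 2 * a)) / 2 := by linarith
    refine ⟨1 - 2 * a, (m - 1 + 2 * (1 - 2 * a)) / 2, by linarith, by linarith, hprof, ?_⟩
    set β := (m - 1 + 2 * (1 - 2 * a)) / 2 with hβd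
    have e : β * (m - 1 + 2 * (1 - 2 * a)) - β ^ 2 = β ^ 2 := by rw [hβd]; ring
    have hβ2 : (2 * m + 2 * μ - 1) / 4 ≤ β ^ 2 := by
      -- `(m+μ)² ≥ 2(m+μ) - 1`
      nlinarith [sq_nonneg (m + μ - 1)]
    have hquad := two_term_estimate_of_lt_one (C := C) hm hm1 hμ hμ1
    rw [e, hcC]
    calc (m + 2 * μ - 1) * C ≤ (3 * μ + C + D) * ((2 * m + 2 * μ - 1) / 4) := by linarith
      _ ≤ K * β ^ 2 := mul_le_mul hKD hβ2 (by positivity) hK.le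

/-! ### Superharmonicity of concave functions, tested against Lipschitz functions -/

section SecondDifference

open Filter Topology

/-- Summation by parts turns the product of first differences into `u` times the negative of a
second difference of `d`. -/
lemma integral_sub_mul_sub_nonneg {E : Type*} [NormedAddCommGroup E] [MeasurableSpace E]
    [BorelSpace E] {μ : Measure E} [μ.IsAddHaarMeasure] {d u : E → ℝ}
    (hd : Continuous d) (hu : Continuous u)
    (hc : HasCompactSupport u) (w : E)
    (h : ∀ x, 0 ≤ u x * (2 * d x - d (x + w) - d (x - w))) :
    0 ≤ ∫ x, (d (x + w) - d x) * (u (x + w) - u x) ∂μ := by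
  have hcw : HasCompactSupport fun x => u (x + w) := hc.comp_homeomorph (Homeomorph.addRight w)
  have hdw : Continuous fun x => d (x + w) := by fun_prop
  have hdw' : Continuous fun x => d (x - w) := by fun_prop
  have huw : Continuous fun x => u (x + w) := by fun_prop
  have i1 : Integrable (fun x => d (x + w) * u (x + w)) μ :=
    (hdw.mul huw).integrable_of_hasCompactSupport hcw.mul_left
  have i2 : Integrable (fun x => d x * u x) μ :=
    (hd.mul hu).integrable_of_hasCompactSupport hc.mul_left
  have i3 : Integrable (fun x => d (x + w) * u x) μ :=
    (hdw.mul hu).integrable_of_hasCompactSupport hc.mul_left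
  have i4 : Integrable (fun x => d x * u (x + w)) μ :=
    (hd.mul huw).integrable_of_hasCompactSupport hcw.mul_left
  have i5 : Integrable (fun x => d (x - w) * u x) μ :=
    (hdw'.mul hu).integrable_of_hasCompactSupport hc.mul_left
  have e1 : ∫ x, d (x + w) * u (x + w) ∂μ = ∫ x, d x * u x ∂μ :=
    integral_add_right_eq_self (fun x => d x * u x) w
  have e4 : ∫ x, d x * u (x + w) ∂μ = ∫ x, d (x - w) * u x ∂μ := by
    rw [← integral_add_right_eq_self (fun x => d (x - w) * u x) w]
    simp
  have e : ∫ x, (d (x + w) - d x) * (u (x + w) - u x) ∂μ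
      = ∫ x, u x * (2 * d x - d (x + w) - d (x - w)) ∂μ := by
    calc _ = ∫ x, ((d (x + w) * u (x + w) + d x * u x) -
            (d (x + w) * u x + d x * u (x + w))) ∂μ := by
          congr 1; ext x; ring
      _ = ∫ x, ((d x * u x + d x * u x) - (d (x + w) * u x + d (x - w) * u x)) ∂μ := by
          have j1 : Integrable (fun x => d (x + w) * u (x + w) + d x * u x) μ := i1.add i2
          have j2 : Integrable (fun x => d (x + w) * u x + d x * u (x + w)) μ := i3.add i4
          have j3 : Integrable (fun x => d x * u x + d x * u x) μ := i2.add i2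
          have j4 : Integrable (fun x => d (x + w) * u x + d (x - w) * u x) μ := i3.add i5
          rw [integral_sub j1 j2, integral_sub j3 j4, integral_add i1 i2, integral_add i3 i4,
            integral_add i2 i2, integral_add i3 i5, e1, e4]
      _ = _ := by congr 1; ext x; ring
  rw [e]
  exact integral_nonneg h

variable {E : Type*} [NormedAddCommGroup E] [NormedSpace ℝ E] [MeasurableSpace E] [BorelSpace E]
  [FiniteDimensional ℝ E] {μ : Measure E} [μ.IsAddHaarMeasure]

/-- A Lipschitz function that is concave on `Ω` has nonpositive second derivative in every
direction, in the weak sense against nonnegative Lipschitz functions compactly supported in `Ω`. -/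
lemma integral_lineDeriv_mul_lineDeriv_nonneg {d u : E → ℝ} {C C' : NNReal}
    (hd : LipschitzWith C d) (hu : LipschitzWith C' u) (hc : HasCompactSupport u)
    (h0 : ∀ x, 0 ≤ u x) {Ω : Set E} (hΩ : IsOpen Ω) (hs : tsupport u ⊆ Ω)
    (hconc : ConcaveOn ℝ Ω d) (v : E) :
    0 ≤ ∫ x, lineDeriv ℝ d x v * lineDeriv ℝ u x v ∂μ := by
  have hlim : Tendsto (fun t : ℝ => ∫ x, (t⁻¹ • (d (x + t • v) - d x)) *
      (t⁻¹ • (u (x + t • v) - u x)) ∂μ) (𝓝[>] 0)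
      (𝓝 (∫ x, lineDeriv ℝ d x v * lineDeriv ℝ u x v ∂μ)) := by
    let K := Metric.cthickening ‖v‖ (tsupport u)
    have hK : IsCompact K := IsCompact.cthickening hc
    have hquot : ∀ {f : E → ℝ} {L : NNReal}, LipschitzWith L f → ∀ t : ℝ, 0 < t → ∀ x,
        ‖t⁻¹ • (f (x + t • v) - f x)‖ ≤ L * ‖v‖ := by
      intro f L hf t ht x
      calc ‖t⁻¹ • (f (x + t • v) - f x)‖ = t⁻¹ * ‖f (x + t • v) - f x‖ := by simp [ht.le]
        _ ≤ t⁻¹ * (L * ‖(x + t • v) - x‖) := by gcongr; exact hf.norm_sub_le _ _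
        _ = L * ‖v‖ := by simp [field, norm_smul, abs_of_nonneg ht.le]
    apply tendsto_integral_filter_of_dominated_convergence
      (K.indicator fun _ => (C * ‖v‖) * (C' * ‖v‖))
    · filter_upwards with t
      have hd' := hd.continuous
      have hu' := hu.continuous
      refine Continuous.aestronglyMeasurable ?_
      fun_prop
    · filter_upwards [Ioc_mem_nhdsGT (zero_lt_one' ℝ)] with t ht
      filter_upwards with x
      by_cases hx : x ∈ K
      · rw [Set.indicator_of_mem hx, norm_mul]
        exact mul_le_mul (hquot hd t ht.1 x) (hquot hu t ht.1 x) (norm_nonneg _) (by positivity)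
      · have A : u x = 0 := by
          rw [← Function.notMem_support]
          contrapose! hx
          exact Metric.self_subset_cthickening _ (subset_tsupport _ hx)
        have B : u (x + t • v) = 0 := by
          rw [← Function.notMem_support]
          contrapose! hx
          apply Metric.mem_cthickening_of_dist_le _ _ ‖v‖ (tsupport u) (subset_tsupport _ hx)
          simp only [dist_eq_norm, sub_add_cancel_left, norm_neg, norm_smul, Real.norm_eq_abs,
            abs_of_pos ht.1]
          exact mul_le_of_le_one_left (norm_nonneg v) ht.2
        simp [A, B, Set.indicator_of_notMem hx]
    · rw [integrable_indicator_iff hK.measurableSet]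
      exact integrableOn_const hK.measure_lt_top.ne
    · filter_upwards [hd.ae_lineDifferentiableAt v, hu.ae_lineDifferentiableAt v] with x hx hx'
      exact hx.hasLineDerivAt.tendsto_slope_zero_right.mul
        hx'.hasLineDerivAt.tendsto_slope_zero_right
  refine ge_of_tendsto hlim ?_
  obtain ⟨ε, hε, hεΩ⟩ := IsCompact.exists_thickening_subset_open hc hΩ hs
  have hsmall : ∀ᶠ t : ℝ in 𝓝[>] 0, ‖t • v‖ < ε := by
    have : Tendsto (fun t : ℝ => ‖t • v‖) (𝓝[>] 0) (𝓝 0) := by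
      have h : Continuous fun t : ℝ => ‖t • v‖ := by fun_prop
      simpa using (h.tendsto 0).mono_left nhdsWithin_le_nhds
    exact this.eventually_lt_const hε
  filter_upwards [hsmall] with t ht
  have key := integral_sub_mul_sub_nonneg (μ := μ) hd.continuous hu.continuous hc (t • v)
    (fun x => by
    by_cases hx : x ∈ tsupport u
    · refine mul_nonneg (h0 x) ?_
      have h1 : x + t • v ∈ Ω := hεΩ (Metric.mem_thickening_iff.2 ⟨x, hx, by simpa using ht⟩)
      have h2 : x - t • v ∈ Ω := hεΩ (Metric.mem_thickening_iff.2 ⟨x, hx, by simpa using ht⟩)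
      have := hconc.2 h1 h2 (show (0 : ℝ) ≤ 1 / 2 by norm_num)
        (show (0 : ℝ) ≤ 1 / 2 by norm_num) (by norm_num)
      rw [show (1 / 2 : ℝ) • (x + t • v) + (1 / 2 : ℝ) • (x - t • v) = x by module] at this
      simp only [smul_eq_mul] at this
      linarith
    · simp [image_eq_zero_of_notMem_tsupport hx])
  have e : ∀ x, (t⁻¹ • (d (x + t • v) - d x)) * (t⁻¹ • (u (x + t • v) - u x))
      = t⁻¹ ^ 2 * ((d (x + t • v) - d x) * (u (x + t • v) - u x)) := fun x => by
    simp only [smul_eq_mul]; ring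
  simp only [e, integral_const_mul]
  exact mul_nonneg (by positivity) key

end SecondDifference

section Gradient

open scoped InnerProductSpace

variable {E : Type*} [NormedAddCommGroup E] [InnerProductSpace ℝ E] [MeasurableSpace E]
  [BorelSpace E] [FiniteDimensional ℝ E] {μ : Measure E} [μ.IsAddHaarMeasure]

/-- Weak superharmonicity `∫ ⟪∇d, ∇u⟫ ≥ 0` of a Lipschitz function `d` that is concave on `Ω`. -/
lemma integral_inner_gradient_nonneg {d u : E → ℝ} {C C' : NNReal}
    (hd : LipschitzWith C d) (hu : LipschitzWith C' u) (hc : HasCompactSupport u)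
    (h0 : ∀ x, 0 ≤ u x) {Ω : Set E} (hΩ : IsOpen Ω) (hs : tsupport u ⊆ Ω)
    (hconc : ConcaveOn ℝ Ω d) :
    Integrable (fun x => ⟪gradient d x, gradient u x⟫_ℝ) μ ∧
      0 ≤ ∫ x, ⟪gradient d x, gradient u x⟫_ℝ ∂μ := by
  let b := stdOrthonormalBasis ℝ E
  have hint : ∀ i, Integrable (fun x => lineDeriv ℝ d x (b i) * lineDeriv ℝ u x (b i)) μ := by
    intro i
    have hu1 : Integrable (fun x => lineDeriv ℝ u x (b i)) μ := by
      have hsupp : HasCompactSupport fun x => lineDeriv ℝ u x (b i) := by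
        refine HasCompactSupport.intro hc fun x hx => ?_
        have : u =ᶠ[nhds x] fun _ => (0 : ℝ) := notMem_tsupport_iff_eventuallyEq.1 hx
        rw [this.lineDeriv_eq]
        simp [lineDeriv]
      refine (integrableOn_iff_integrable_of_support_subset (subset_tsupport _)).1 ?_
      exact ((hu.memLp_lineDeriv (b i)).locallyIntegrable le_top).integrableOn_isCompact hsupp
    exact hu1.bdd_mul (c := C * ‖b i‖)
      (aestronglyMeasurable_lineDeriv hd.continuous μ)
      (.of_forall fun x => norm_lineDeriv_le_of_lipschitz ℝ hd)
  have hae : (fun x => ∑ i, lineDeriv ℝ d x (b i) * lineDeriv ℝ u x (b i)) =ᵐ[μ]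
      fun x => ⟪gradient d x, gradient u x⟫_ℝ := by
    filter_upwards [hd.ae_differentiableAt, hu.ae_differentiableAt] with x hx hx'
    rw [← b.sum_inner_mul_inner]
    refine Finset.sum_congr rfl fun i _ => ?_
    rw [hx.lineDeriv_eq_fderiv, hx'.lineDeriv_eq_fderiv, real_inner_comm (gradient u x) (b i),
      gradient, gradient, InnerProductSpace.toDual_symm_apply, InnerProductSpace.toDual_symm_apply]
  refine ⟨(integrable_finsetSum _ fun i _ => hint i).congr hae, ?_⟩
  rw [← integral_congr_ae hae, integral_finsetSum _ fun i _ => hint i]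
  exact Finset.sum_nonneg fun i _ =>
    integral_lineDeriv_mul_lineDeriv_nonneg hd hu hc h0 hΩ hs hconc (b i)

end Gradient

/-! ### The distance to the boundary of a convex set -/

section Distance

open Metric

lemma le_infDist_frontier {X : Type*} [PseudoMetricSpace X] {Ω : Set X} {x : X} {r : ℝ}
    (hΩ : IsOpen Ω) (hne : (frontier Ω).Nonempty)
    (h : ball x r ⊆ Ω) : r ≤ infDist x (frontier Ω) := by
  refine (le_infDist hne).2 fun y hy => ?_
  by_contra! hlt
  have hyΩ : y ∈ Ω := h (by rwa [mem_ball, dist_comm])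
  have := hΩ.inter_frontier_eq
  exact Set.notMem_empty y (this ▸ ⟨hyΩ, hy⟩)

lemma infDist_frontier_pos {X : Type*} [PseudoMetricSpace X] {Ω : Set X} {x : X} (hx : x ∈ Ω)
    (hΩ : IsOpen Ω) (hne : (frontier Ω).Nonempty) :
    0 < infDist x (frontier Ω) := by
  obtain ⟨r, hr, hb⟩ := Metric.isOpen_iff.1 hΩ x hx
  exact hr.trans_le (le_infDist_frontier hΩ hne hb)

variable {E : Type*} [NormedAddCommGroup E] [NormedSpace ℝ E] {Ω : Set E}

lemma ball_infDist_frontier_subset {x : E} (hx : x ∈ Ω) (hΩ : IsOpen Ω) :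
    ball x (infDist x (frontier Ω)) ⊆ Ω := by
  rcases (ball x (infDist x (frontier Ω))).eq_empty_or_nonempty with h | h
  · simp [h]
  refine (convex_ball x _).isPreconnected.subset_of_closure_inter_subset hΩ
    ⟨x, mem_ball_self (nonempty_ball.1 h), hx⟩ ?_
  rintro y ⟨hyc, hyb⟩
  by_contra hy
  have : y ∈ frontier Ω := ⟨hyc, by rwa [hΩ.interior_eq]⟩
  have := infDist_le_dist_of_mem (x := x) this
  rw [mem_ball, dist_comm] at hyb
  linarith

/-- The distance to the boundary of a convex open set is concave in the set: a convex combination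
of two inscribed balls is an inscribed ball. -/
lemma concaveOn_infDist_frontier (hΩ : IsOpen Ω) (hconv : Convex ℝ Ω)
    (hne : (frontier Ω).Nonempty) : ConcaveOn ℝ Ω fun x => infDist x (frontier Ω) := by
  refine ⟨hconv, fun x hx y hy a b ha hb hab => le_infDist_frontier hΩ hne fun z hz => ?_⟩
  set r := infDist x (frontier Ω)
  set s := infDist y (frontier Ω)
  have hr : 0 < r := infDist_frontier_pos hx hΩ hne
  have hs : 0 < s := infDist_frontier_pos hy hΩ hne
  simp only [smul_eq_mul] at hz
  set ρ := a * r + b * s with hρ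
  have hρ0 : 0 < ρ := dist_nonneg.trans_lt (mem_ball.1 hz)
  set w := z - (a • x + b • y) with hw
  have hwn : ‖w‖ < ρ := by rwa [mem_ball, dist_eq_norm] at hz
  have hmem : ∀ {p : E} {q : ℝ}, 0 < q → p + (q / ρ) • w ∈ ball p q := by
    intro p q hq
    rw [mem_ball, dist_eq_norm, add_sub_cancel_left, norm_smul, Real.norm_of_nonneg (by positivity),
      div_mul_eq_mul_div, div_lt_iff₀ hρ0]
    exact mul_lt_mul_of_pos_left hwn hq
  have h1 := ball_infDist_frontier_subset hx hΩ (hmem (p := x) hr)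
  have h2 := ball_infDist_frontier_subset hy hΩ (hmem (p := y) hs)
  have h3 := hconv h1 h2 ha hb hab
  have e : a • (x + (r / ρ) • w) + b • (y + (s / ρ) • w) = z := by
    have : a * (r / ρ) + b * (s / ρ) = 1 := by field_simp; exact hρ.symm
    calc _ = (a • x + b • y) + (a * (r / ρ) + b * (s / ρ)) • w := by module
      _ = z := by rw [this, one_smul, hw]; abel
  rwa [e] at h3

end Distance

/-- Moving straight towards a nearest boundary point decreases the distance at unit speed. -/
lemma norm_gradient_infDist_eq_one {E : Type*} [NormedAddCommGroup E] [InnerProductSpace ℝ E]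
    [FiniteDimensional ℝ E] {s : Set E} (hs : IsClosed s) (hne : s.Nonempty) {x : E}
    (hx : 0 < Metric.infDist x s) (hd : DifferentiableAt ℝ (fun y => Metric.infDist y s) x) :
    ‖gradient (fun y => Metric.infDist y s) x‖ = 1 := by
  rw [gradient, LinearIsometryEquiv.norm_map]
  refine le_antisymm ?_ ?_
  · simpa using norm_fderiv_le_of_lipschitz ℝ (Metric.lipschitz_infDist_pt s)
  · obtain ⟨y, hy, hxy⟩ := hs.exists_infDist_eq_dist hne x
    set D := fderiv ℝ (fun y => Metric.infDist y s) x
    have hline : HasDerivAt (fun t : ℝ => Metric.infDist (x + t • (y - x)) s) (D (y - x)) 0 := by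
      have := hd.hasFDerivAt.hasLineDerivAt (y - x)
      exact this
    have hlin : HasDerivAt (fun t : ℝ => (1 - t) * dist x y) (-dist x y) 0 := by
      simpa using ((hasDerivAt_id (0 : ℝ)).const_sub 1).mul_const (dist x y)
    have hle : D (y - x) ≤ -dist x y := by
      have h1 := hline.tendsto_slope_zero_right
      have h2 := hlin.tendsto_slope_zero_right
      refine le_of_tendsto_of_tendsto h1 h2 ?_
      filter_upwards [Ioc_mem_nhdsGT (zero_lt_one' ℝ)] with t ht
      have : Metric.infDist (x + t • (y - x)) s ≤ (1 - t) * dist x y := by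
        refine (Metric.infDist_le_dist_of_mem hy).trans_eq ?_
        rw [dist_eq_norm, dist_eq_norm, show x + t • (y - x) - y = (1 - t) • (x - y) by module,
          norm_smul, Real.norm_of_nonneg (by linarith [ht.2])]
      simp only [zero_add, smul_eq_mul, zero_smul, add_zero, sub_zero, one_mul]
      rw [← hxy] at this ⊢
      exact mul_le_mul_of_nonneg_left (by linarith) (inv_nonneg.2 ht.1.le)
    have hpos : 0 < dist x y := hxy ▸ hx
    have hn : dist x y ≤ ‖D‖ * dist x y := by
      calc dist x y ≤ |D (y - x)| := by rw [abs_of_nonpos (by linarith)]; linarith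
        _ ≤ ‖D‖ * ‖y - x‖ := D.le_opNorm _
        _ = _ := by rw [dist_comm, dist_eq_norm]
    exact le_of_mul_le_mul_right (by linarith) hpos

/-! ### Hardy inequalities from a radial profile -/

lemma exists_lipschitzWith_mul_of_bounded {X : Type*} [PseudoMetricSpace X] {f g : X → ℝ}
    {A B Kf Kg : NNReal} (hf : LipschitzWith Kf f) (hg : LipschitzWith Kg g)
    (hA : ∀ x, |f x| ≤ A) (hB : ∀ x, |g x| ≤ B) : ∃ K, LipschitzWith K fun x => f x * g x := by
  refine ⟨B * Kf + A * Kg, LipschitzWith.of_dist_le_mul fun x y => ?_⟩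
  have h1 := hf.dist_le_mul x y
  have h2 := hg.dist_le_mul x y
  rw [Real.dist_eq] at h1 h2 ⊢
  calc |f x * g x - f y * g y| = |(f x - f y) * g x + f y * (g x - g y)| := by ring_nf
    _ ≤ |f x - f y| * |g x| + |f y| * |g x - g y| := by
        rw [← abs_mul, ← abs_mul]; exact abs_add_le _ _
    _ ≤ (Kf * dist x y) * B + A * (Kg * dist x y) := by
        gcongr
        exacts [hB x, hA y]
    _ = _ := by push_cast; ring

section Hardy

open scoped InnerProductSpace
open Metric

lemma integrable_sq_mul_comp_infDist_frontier {E : Type*} [NormedAddCommGroup E]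
    [MeasurableSpace E] [BorelSpace E] {μ : Measure E} [μ.IsAddHaarMeasure] {Ω : Set E} {g : E → ℝ}
    (hΩ : IsOpen Ω) (hne : (frontier Ω).Nonempty)
    (hg : Continuous g) (hc : HasCompactSupport g) (hs : tsupport g ⊆ Ω) {ψ : ℝ → ℝ}
    (hψ : ContinuousOn ψ (Set.Ioi 0)) :
    Integrable (fun x => g x ^ 2 * ψ (infDist x (frontier Ω))) μ := by
  refine IntegrableOn.integrable_of_forall_notMem_eq_zero (s := tsupport g) ?_ fun x hx => by
    simp [image_eq_zero_of_notMem_tsupport hx]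
  refine ContinuousOn.integrableOn_compact hc ?_
  refine (hg.pow 2).continuousOn.mul (hψ.comp (continuous_infDist_pt _).continuousOn fun x hx => ?_)
  exact infDist_frontier_pos (hs hx) hΩ hne

/-- The test function `g² φ(δ)` is Lipschitz, since `δ` stays in a compact subset of `(0, ∞)` on the
support of `g`. -/
lemma exists_lipschitzWith_sq_mul_comp_infDist_frontier {E : Type*} [NormedAddCommGroup E]
    [NormedSpace ℝ E] {Ω : Set E} {g : E → ℝ} (hΩ : IsOpen Ω)
    (hne : (frontier Ω).Nonempty) (hg : ContDiff ℝ 1 g) (hc : HasCompactSupport g)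
    (hs : tsupport g ⊆ Ω) {φ : ℝ → ℝ} (hφ : ContDiffOn ℝ 1 φ (Set.Ioi 0)) :
    ∃ K, LipschitzWith K fun x => g x ^ 2 * φ (infDist x (frontier Ω)) := by
  obtain ⟨ε, hε, hεΩ⟩ := IsCompact.exists_thickening_subset_open hc hΩ hs
  obtain ⟨M, hM⟩ := (hc.image (continuous_infDist_pt (frontier Ω))).bddAbove
  have hlow : ∀ x ∈ tsupport g, ε ≤ infDist x (frontier Ω) := fun x hx =>
    le_infDist_frontier hΩ hne ((ball_subset_thickening hx ε).trans hεΩ)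
  have hup : ∀ x ∈ tsupport g, infDist x (frontier Ω) ≤ M := fun x hx => hM ⟨x, hx, rfl⟩
  -- truncate `δ` to `[ε, max ε M]`, which changes nothing on the support of `g`
  set I := Set.Icc ε (max ε M)
  set p : E → ℝ := fun x => max ε (min (infDist x (frontier Ω)) (max ε M)) with hp
  have hpI : ∀ x, p x ∈ I := fun x => ⟨le_max_left _ _, max_le (le_max_left _ _) (min_le_right _ _)⟩
  have hpL : LipschitzWith 1 p := ((lipschitz_infDist_pt _).min_const _).const_max _
  have hI : I ⊆ Set.Ioi 0 := fun s hs => hε.trans_le hs.1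
  obtain ⟨L, hL⟩ := (hφ.mono hI).exists_lipschitzOnWith one_ne_zero (convex_Icc _ _) isCompact_Icc
  obtain ⟨B, hB⟩ := isCompact_Icc.exists_bound_of_continuousOn (hφ.mono hI).continuousOn
  have hφL : LipschitzWith (L * 1) fun x => φ (p x) := by
    rw [← lipschitzOnWith_univ]
    exact hL.comp hpL.lipschitzOnWith fun x _ => hpI x
  have hgc : HasCompactSupport fun x => g x ^ 2 := by
    simp only [sq]
    exact hc.mul_left (f := g)
  obtain ⟨L', hL'⟩ := ContDiff.lipschitzWith_of_hasCompactSupport (𝕂 := ℝ) hgc (hg.pow 2)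
    one_ne_zero
  obtain ⟨A, hA⟩ := hgc.exists_bound_of_continuous (hg.continuous.pow 2)
  obtain ⟨K, hK⟩ := exists_lipschitzWith_mul_of_bounded (A := A.toNNReal) (B := B.toNNReal) hL' hφL
    (fun x => (hA x).trans (Real.le_coe_toNNReal A))
    (fun x => (hB _ (hpI x)).trans (Real.le_coe_toNNReal B))
  refine ⟨K, ?_⟩
  convert! hK using 2 with x
  by_cases hx : x ∈ tsupport g
  · rw [hp]
    simp only
    rw [min_eq_left ((hup x hx).trans (le_max_right _ _)), max_eq_right (hlow x hx)]
  · simp [image_eq_zero_of_notMem_tsupport hx]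

variable {E : Type*} [NormedAddCommGroup E] [InnerProductSpace ℝ E] [MeasurableSpace E]
  [BorelSpace E] [FiniteDimensional ℝ E] {μ : Measure E} [μ.IsAddHaarMeasure] {Ω : Set E}
  {g : E → ℝ}

/-- Hardy inequality with a Riccati weight: for a `C¹` profile `φ` that is nonnegative on the range
of the distance `δ` to the boundary of a convex set,
`∫ g² (-φ'(δ) - φ(δ)²) ≤ ∫ |∇g|²`. It is weak superharmonicity of `δ` tested against `g² φ(δ)`,
combined with `2 g φ ⟪∇g, ∇δ⟫ ≤ |∇g|² + g² φ²` and `|∇δ| = 1`. -/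
theorem integral_sq_mul_riccati_le (hΩ : IsOpen Ω) (hconv : Convex ℝ Ω)
    (hne : (frontier Ω).Nonempty) (hg : ContDiff ℝ 1 g) (hc : HasCompactSupport g)
    (hs : tsupport g ⊆ Ω) {φ : ℝ → ℝ} (hφ : ContDiffOn ℝ 1 φ (Set.Ioi 0))
    (hφ0 : ∀ x ∈ Ω, 0 ≤ φ (infDist x (frontier Ω))) :
    ∫ x, g x ^ 2 * (-deriv φ (infDist x (frontier Ω)) - φ (infDist x (frontier Ω)) ^ 2) ∂μ
      ≤ ∫ x, ‖gradient g x‖ ^ 2 ∂μ := by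
  set δ : E → ℝ := fun x => infDist x (frontier Ω) with hδ
  set u : E → ℝ := fun x => g x ^ 2 * φ (δ x) with hu
  have hδL : LipschitzWith 1 δ := lipschitz_infDist_pt _
  obtain ⟨K, hK⟩ := exists_lipschitzWith_sq_mul_comp_infDist_frontier hΩ hne hg hc hs hφ
  have hsu : tsupport u ⊆ tsupport g := by
    refine closure_mono fun x hx => ?_
    contrapose! hx
    simp only [Function.mem_support, not_not] at hx
    simp [hu, hx]
  have huc : HasCompactSupport u := hc.mono' (subset_closure.trans hsu)
  have hu0 : ∀ x, 0 ≤ u x := fun x => by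
    by_cases hx : x ∈ tsupport g
    · exact mul_nonneg (sq_nonneg _) (hφ0 x (hs hx))
    · simp [hu, image_eq_zero_of_notMem_tsupport hx]
  obtain ⟨hint, hnonneg⟩ := integral_inner_gradient_nonneg (μ := μ) hδL hK huc hu0 hΩ
    (hsu.trans hs) (concaveOn_infDist_frontier hΩ hconv hne)
  have hφd : ContinuousOn (deriv φ) (Set.Ioi 0) := hφ.continuousOn_deriv_of_isOpen isOpen_Ioi le_rfl
  have hw : Integrable (fun x => g x ^ 2 * (-deriv φ (δ x) - φ (δ x) ^ 2)) μ :=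
    integrable_sq_mul_comp_infDist_frontier hΩ hne hg.continuous hc hs
      (ψ := fun s => -deriv φ s - φ s ^ 2) (hφd.neg.sub (hφ.continuousOn.pow 2))
  have hgrad : Integrable (fun x => ‖gradient g x‖ ^ 2) μ := by
    have hcont : Continuous fun x => ‖fderiv ℝ g x‖ ^ 2 :=
      (hg.continuous_fderiv one_ne_zero).norm.pow 2
    have hcs : HasCompactSupport fun x => ‖fderiv ℝ g x‖ ^ 2 := by
      simp only [sq]
      exact (hc.fderiv ℝ).norm.mul_left (f := fun x => ‖fderiv ℝ g x‖)
    simpa [gradient] using hcont.integrable_of_hasCompactSupport hcs (μ := μ)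
  have hae : (fun x => ⟪gradient δ x, gradient u x⟫_ℝ) ≤ᵐ[μ]
      fun x => ‖gradient g x‖ ^ 2 - g x ^ 2 * (-deriv φ (δ x) - φ (δ x) ^ 2) := by
    filter_upwards [hδL.ae_differentiableAt] with x hx
    by_cases hxg : x ∈ tsupport g
    · have hpos : 0 < δ x := infDist_frontier_pos (hs hxg) hΩ hne
      have hφx : HasDerivAt φ (deriv φ (δ x)) (δ x) :=
        ((hφ.differentiableOn one_ne_zero).differentiableAt (Ioi_mem_nhds hpos)).hasDerivAt
      have hgx : HasFDerivAt g (fderiv ℝ g x) x := (hg.differentiable one_ne_zero x).hasFDerivAt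
      have hux : HasFDerivAt u (g x ^ 2 • (deriv φ (δ x) • fderiv ℝ δ x)
          + φ (δ x) • ((2 * g x ^ 1) • fderiv ℝ g x)) x := by
        have := (hgx.pow 2).mul (hφx.comp_hasFDerivAt x hx.hasFDerivAt)
        simpa using! this
      have hunit : ⟪gradient δ x, gradient δ x⟫_ℝ = 1 := by
        rw [real_inner_self_eq_norm_sq, norm_gradient_infDist_eq_one isClosed_frontier hne hpos hx,
          one_pow]
      have hG : ∀ (f : E → ℝ) (y : E), ⟪gradient f x, y⟫_ℝ = fderiv ℝ f x y := fun f y =>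
        InnerProductSpace.toDual_symm_apply
      have e : ⟪gradient δ x, gradient u x⟫_ℝ
          = g x ^ 2 * deriv φ (δ x) + 2 * (g x * φ (δ x)) * ⟪gradient g x, gradient δ x⟫_ℝ := by
        rw [real_inner_comm, hG u, hux.fderiv]
        simp only [add_apply, smul_apply, smul_eq_mul]
        rw [← hG g, ← hG δ, hunit]
        ring
      have hsq : 0 ≤ ‖gradient g x - (g x * φ (δ x)) • gradient δ x‖ ^ 2 := by positivity
      rw [norm_sub_sq_real, inner_smul_right, norm_smul, mul_pow, ← real_inner_self_eq_norm_sq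
        (gradient δ x), hunit, Real.norm_eq_abs, sq_abs] at hsq
      rw [e]
      linarith
    · have h0 : gradient u x = 0 := by
        have : u =ᶠ[nhds x] fun _ => (0 : ℝ) :=
          notMem_tsupport_iff_eventuallyEq.1 fun h => hxg (hsu h)
        rw [gradient, this.fderiv_eq]
        simp
      simp [h0, image_eq_zero_of_notMem_tsupport hxg]
  have := hnonneg.trans (integral_mono_ae hint (hgrad.sub hw) hae)
  simp only [Pi.sub_apply] at this
  rw [integral_sub hgrad hw] at this
  linarith

end Hardy

/-- The two-weight Hardy inequality obtained from the profile `φ(s) = α/s - β s^{m-1}/δ₀^m`. -/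
lemma hardy_two_weights {n : ℕ} {Ω : Set (EuclideanSpace ℝ (Fin n))} (hΩ : IsOpen Ω)
    (hconv : Convex ℝ Ω) (hfin : LambHardy.FiniteInradius Ω) (hnonempty : Ω.Nonempty)
    {g : EuclideanSpace ℝ (Fin n) → ℝ} (hg : LambHardy.IsC1c Ω g) {m α β : ℝ} (hm : 0 < m)
    (hβ : 0 ≤ β) (hβα : β ≤ α) :
    (α - α ^ 2) * (∫ x in Ω, |g x| ^ 2 / LambHardy.bdryDist Ω x ^ 2)
      + (β * (m - 1 + 2 * α) - β ^ 2) / LambHardy.inradius Ω ^ m *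
        (∫ x in Ω, |g x| ^ 2 / LambHardy.bdryDist Ω x ^ (2 - m))
      ≤ ∫ x in Ω, ‖gradient g x‖ ^ 2 := by
  obtain ⟨hgC, hc, hs⟩ := hg
  have hne : (frontier Ω).Nonempty := nonempty_frontier_iff.2 ⟨hnonempty, hfin.1⟩
  set d0 := LambHardy.inradius Ω with hd0
  have hle : ∀ x ∈ Ω, LambHardy.bdryDist Ω x ≤ d0 := fun x hx =>
    le_csSup hfin.2 ⟨x, hx, rfl⟩
  have hpos : ∀ x ∈ Ω, 0 < LambHardy.bdryDist Ω x := fun x hx => infDist_frontier_pos hx hΩ hne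
  have hd0pos : 0 < d0 := by
    obtain ⟨x, hx⟩ := hnonempty
    exact (hpos x hx).trans_le (hle x hx)
  set R := d0 ^ m with hR
  have hRpos : 0 < R := Real.rpow_pos_of_pos hd0pos m
  let φ : ℝ → ℝ := fun s => α / s - β * s ^ (m - 1) / R
  have hderiv : ∀ s, 0 < s → HasDerivAt φ (-α / s ^ 2 - β * ((m - 1) * s ^ (m - 1 - 1)) / R) s := by
    intro s hs
    have h1 : HasDerivAt (fun s : ℝ => α / s) (-α / s ^ 2) s := by
      simpa [div_eq_mul_inv] using (hasDerivAt_inv hs.ne').const_mul α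
    exact h1.sub (((Real.hasDerivAt_rpow_const (Or.inl hs.ne')).const_mul β).div_const R)
  have hφ : ContDiffOn ℝ 1 φ (Set.Ioi 0) := by
    refine ContDiffOn.sub ?_ ?_
    · exact contDiffOn_const.div contDiffOn_id fun s hs => (Set.mem_Ioi.1 hs).ne'
    · refine (contDiffOn_const.mul ?_).div_const R
      exact fun s hs => (Real.contDiffAt_rpow_const_of_ne (Set.mem_Ioi.1 hs).ne').contDiffWithinAt
  have hpow : ∀ s, 0 < s → s ≤ d0 → s ^ m ≤ R := fun s hs hsd =>
    Real.rpow_le_rpow hs.le hsd hm.le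
  have hφ0 : ∀ x ∈ Ω, 0 ≤ φ (Metric.infDist x (frontier Ω)) := by
    intro x hx
    have hs := hpos x hx
    have hsR := hpow _ hs (hle x hx)
    change 0 ≤ φ (LambHardy.bdryDist Ω x)
    set s := LambHardy.bdryDist Ω x
    have e : φ s = (α - β * (s ^ m / R)) / s := by
      simp only [φ]
      rw [Real.rpow_sub_one hs.ne']
      field_simp
    have h1 : s ^ m / R ≤ 1 := (div_le_one hRpos).2 hsR
    rw [e]
    exact div_nonneg (by nlinarith) hs.le
  have hmain := integral_sq_mul_riccati_le (μ := volume) hΩ hconv hne hgC hc hs hφ hφ0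
  have hgΩ : ∀ x, x ∉ Ω → g x = 0 := fun x hx =>
    image_eq_zero_of_notMem_tsupport fun h => hx (hs h)
  have hX : Integrable (fun x => |g x| ^ 2 / LambHardy.bdryDist Ω x ^ 2) := by
    have := integrable_sq_mul_comp_infDist_frontier (μ := volume) hΩ hne hgC.continuous hc hs
      (ψ := fun s => (s ^ 2)⁻¹)
      ((continuousOn_id.pow 2).inv₀ fun s hs => pow_ne_zero 2 (Set.mem_Ioi.1 hs).ne')
    simpa [div_eq_mul_inv, LambHardy.bdryDist] using this
  have hY : Integrable (fun x => |g x| ^ 2 / LambHardy.bdryDist Ω x ^ (2 - m)) := by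
    have := integrable_sq_mul_comp_infDist_frontier (μ := volume) hΩ hne hgC.continuous hc hs
      (ψ := fun s => (s ^ (2 - m))⁻¹)
      ((continuousOn_id.rpow_const fun s hs => Or.inl (Set.mem_Ioi.1 hs).ne').inv₀
        fun s hs => (Real.rpow_pos_of_pos (Set.mem_Ioi.1 hs) _).ne')
    simpa [div_eq_mul_inv, LambHardy.bdryDist] using this
  have hW : Integrable (fun x => g x ^ 2 * (-deriv φ (Metric.infDist x (frontier Ω)) -
      φ (Metric.infDist x (frontier Ω)) ^ 2)) :=
    integrable_sq_mul_comp_infDist_frontier hΩ hne hgC.continuous hc hs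
      (ψ := fun s => -deriv φ s - φ s ^ 2)
      ((hφ.continuousOn_deriv_of_isOpen isOpen_Ioi le_rfl).neg.sub (hφ.continuousOn.pow 2))
  rw [setIntegral_eq_integral_of_forall_compl_eq_zero fun x hx => by simp [hgΩ x hx],
    setIntegral_eq_integral_of_forall_compl_eq_zero fun x hx => by simp [hgΩ x hx],
    setIntegral_eq_integral_of_forall_compl_eq_zero fun x hx => ?_, ← integral_const_mul,
    ← integral_const_mul, ← integral_add (hX.const_mul _) (hY.const_mul _)]
  · refine (integral_mono ((hX.const_mul _).add (hY.const_mul _)) hW fun x => ?_).trans hmain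
    by_cases hx : x ∈ Ω
    · have hs := hpos x hx
      have hsR := hpow _ hs (hle x hx)
      simp only [Pi.add_apply]
      change _ ≤ g x ^ 2 * (-deriv φ (LambHardy.bdryDist Ω x) - φ (LambHardy.bdryDist Ω x) ^ 2)
      set s := LambHardy.bdryDist Ω x
      rw [(hderiv s hs).deriv, sq_abs]
      simp only [φ]
      rw [Real.rpow_sub_one hs.ne', Real.rpow_sub_one hs.ne', Real.rpow_sub hs, Real.rpow_two]
      obtain ⟨t, ht⟩ : ∃ t, t = s ^ m := ⟨_, rfl⟩
      have ht0 : 0 < t := ht ▸ Real.rpow_pos_of_pos hs m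
      rw [← ht] at hsR ⊢
      -- the difference is `β² g² t (R - t) / (R s)²`, with `t = s ^ m ≤ R = δ₀ ^ m`
      rw [← sub_nonneg]
      have e : g x ^ 2 * (-(-α / s ^ 2 - β * ((m - 1) * (t / s / s)) / R) -
          (α / s - β * (t / s) / R) ^ 2) - ((α - α ^ 2) * (g x ^ 2 / s ^ 2) +
          (β * (m - 1 + 2 * α) - β ^ 2) / R * (g x ^ 2 / (s ^ 2 / t)))
          = β ^ 2 * g x ^ 2 * t * (R - t) / (R * s) ^ 2 := by
        field_simp
        ring
      rw [e]
      have : 0 ≤ R - t := sub_nonneg.2 hsR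
      positivity
    · simp [hgΩ x hx]
  · have : g =ᶠ[nhds x] fun _ => (0 : ℝ) :=
      notMem_tsupport_iff_eventuallyEq.1 fun h => hx (hs h)
    rw [gradient, this.fderiv_eq]
    simp

theorem theorem7 (n : ℕ) (Ω : Set (EuclideanSpace ℝ (Fin n)))
    (hΩ_open : IsOpen Ω) (hΩ_convex : Convex ℝ Ω) (hΩ_inradius : LambHardy.FiniteInradius Ω)
    (g : EuclideanSpace ℝ (Fin n) → ℝ) (hg : LambHardy.IsC1c Ω g) :
    (∀ m ν lam c : ℝ, 1 < m → ν ∈ Set.Icc 0 (1 / m) → lam ∈ Set.Ico 0 ((1 + ν * m) / 2) →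
      LambHardy.IsLambConstant m ν lam c →
      (1 - ν ^ 2 * m ^ 2) / 4 * (∫ x in Ω, |g x| ^ 2 / LambHardy.bdryDist Ω x ^ 2)
        + (c ^ 2 + (m - 1) * (lam - lam ^ 2)) / LambHardy.inradius Ω ^ m *
          (∫ x in Ω, |g x| ^ 2 / LambHardy.bdryDist Ω x ^ (2 - m))
        ≤ 4 * ((1 + ν * m) / 2 - lam ^ 2) * (∫ x in Ω, ‖gradient g x‖ ^ 2)) ∧
    (∀ m ν lam c : ℝ, 0 < m → ν ∈ Set.Icc 0 (1 / m) → lam ≤ 0 →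
      LambHardy.IsLambConstant m ν lam c →
      (1 - ν ^ 2 * m ^ 2) / 4 * (∫ x in Ω, |g x| ^ 2 / LambHardy.bdryDist Ω x ^ 2)
        + c ^ 2 / LambHardy.inradius Ω ^ m *
          (∫ x in Ω, |g x| ^ 2 / LambHardy.bdryDist Ω x ^ (2 - m))
        ≤ (2 * (1 + ν * m) + |lam|) * (∫ x in Ω, ‖gradient g x‖ ^ 2)) := by
  rcases Ω.eq_empty_or_nonempty with rfl | hne
  · simp
  have hpoint : ∀ x, 0 ≤ LambHardy.bdryDist Ω x := fun x => Metric.infDist_nonneg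
  have hd0 : 0 ≤ LambHardy.inradius Ω := Real.sSup_nonneg (by rintro _ ⟨x, -, rfl⟩; exact hpoint x)
  have hX : 0 ≤ ∫ x in Ω, |g x| ^ 2 / LambHardy.bdryDist Ω x ^ 2 :=
    integral_nonneg fun x => by positivity
  -- it suffices to dominate both weights, after dividing by the constant `K` on the right
  have key : ∀ {m p q K : ℝ}, 0 < m → 0 ≤ K → (∃ α β : ℝ, 0 ≤ β ∧ β ≤ α ∧ p ≤ K * (α - α ^ 2) ∧
      q ≤ K * (β * (m - 1 + 2 * α) - β ^ 2)) →
      p * (∫ x in Ω, |g x| ^ 2 / LambHardy.bdryDist Ω x ^ 2)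
        + q / LambHardy.inradius Ω ^ m *
          (∫ x in Ω, |g x| ^ 2 / LambHardy.bdryDist Ω x ^ (2 - m))
        ≤ K * (∫ x in Ω, ‖gradient g x‖ ^ 2) := by
    rintro m p q K hm hK ⟨α, β, hβ, hβα, hp, hq⟩
    have hY : 0 ≤ ∫ x in Ω, |g x| ^ 2 / LambHardy.bdryDist Ω x ^ (2 - m) :=
      integral_nonneg fun x => div_nonneg (by positivity) (Real.rpow_nonneg (hpoint x) _)
    have hR : 0 ≤ LambHardy.inradius Ω ^ m := Real.rpow_nonneg hd0 m
    refine le_trans ?_ (mul_le_mul_of_nonneg_left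
      (hardy_two_weights hΩ_open hΩ_convex hΩ_inradius hne hg hm hβ hβα) hK)
    rw [mul_add, ← mul_assoc, ← mul_assoc, ← mul_div_assoc]
    gcongr
  have hνm : ∀ {m ν : ℝ}, 0 < m → ν ∈ Set.Icc 0 (1 / m) → 0 ≤ ν * m ∧ ν * m ≤ 1 := fun hm hν =>
    ⟨mul_nonneg hν.1 hm.le, (le_div_iff₀ hm).1 hν.2⟩
  constructor
  · intro m ν lam c hm hν hlam hc
    have hm0 : 0 < m := by linarith
    obtain ⟨ha0, ha1⟩ := hνm hm0 hν
    have hb := hc.two_term_bound hm0 hν.1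
    have hsq : lam ^ 2 ≤ lam := by nlinarith [hlam.1, hlam.2]
    refine key hm0 (by linarith [hlam.2]) ?_
    have hb' : c ^ 2 / (m + 2 * ((1 + ν * m) / 2) - 1) ≤ (1 + ν * m) / 2 - lam := by
      rw [show m + 2 * ((1 + ν * m) / 2) - 1 = m + ν * m by ring]
      exact (le_add_of_nonneg_right (by positivity)).trans hb
    have := exists_profile_of_nonneg hm (by linarith) (by linarith) hlam.1 hlam.2 hb'
    rwa [show (1 + ν * m) / 2 * (1 - (1 + ν * m) / 2) = (1 - ν ^ 2 * m ^ 2) / 4 by ring] at this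
  · intro m ν lam c hm hν hlam hc
    obtain ⟨ha0, ha1⟩ := hνm hm hν
    have hb := hc.two_term_bound hm hν.1
    refine key hm (by positivity) ?_
    rw [← show m + 2 * ((1 + ν * m) / 2) - 1 = m + ν * m by ring,
      ← show 2 * m + 2 * ((1 + ν * m) / 2) - 1 = 2 * m + ν * m by ring] at hb
    have := exists_profile_of_nonpos hm (by linarith) (by linarith) hlam hb
    rwa [show (1 + ν * m) / 2 * (1 - (1 + ν * m) / 2) = (1 - ν ^ 2 * m ^ 2) / 4 by ring,
      show 4 * ((1 + ν * m) / 2) - lam = 2 * (1 + ν * m) + |lam| by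
        rw [abs_of_nonpos hlam]; ring] at this
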